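/- Let $(V,\circ,e)$ be a Euclidean Jordan algebra with identity: $V$ is a finite-dimensional real vector space with a bilinear operation $\circ$ such that $x\circ y=y\circ x$, $x\circ(x^2\circ y)=x^2\circ(x\circ y)$ and $x\circ e=x$ for all $x,y\in V$ (where $x^2=x\circ x$), and there is a positive definite bilinear form $B$ on $V$ that is associative, i.e. $B(x\circ y,w)=B(x,y\circ w)$. The rank $r$ of $V$ is the smallest integer such that $e,x,\dots,x^r$ are linearly dependent for every $x\in V$. Every $x\in V$ has a spectral decomposition $x=\sum_i\lambda_i(x)c_i$, where $(c_i)$ is a Jordan frame (nonzero primitive idempotents with $c_i\circ c_j=0$ for $i\neq j$ and $\sum_i c_i=e$); the $\lambda_i(x)\in\mathbb{R}$ are the eigenvalues of $x$. Put $\operatorname{trace}(x)=\sum_i\lambda_i(x)$, $\langle x,y\rangle=\operatorname{trace}(x\circ y)$, $\|x\|_F=\sqrt{\langle x,x\rangle}$ and $\|x\|=\max_i|\lambda_i(x)|$. Let $\Omega=\operatorname{int}\{x^2: x\in V\}$, with closure $\bar\Omega$, let $v^+$ denote the projection of $v\in V$ on $\bar\Omega$ (the nearest point with respect to $\|\cdot\|_F$),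 and let $\Delta(\Omega)=\{x\in\bar\Omega:\langle e,x\rangle=1\}$. Let $L\subseteq V$ be a linear subspace and let $P:V\to V$ be the orthogonal projection onto $L$ with respect to $\langle\cdot,\cdot\rangle$. The perceptron scheme picks $z_0\in\Delta(\Omega)$, sets $t:=0$, and, while $Pz_t\notin\Omega$ and $\|(Pz_t)^+\|_F>\frac{1}{4r}\|z_t\|$, performs the following iteration: pick any $u\in\Delta(\Omega)$ with $\langle u,Pz_t\rangle\le 0$, let $$z_{t+1}:=\Bigl(1-\frac{1}{t+1}\Bigr)z_t+\frac{1}{t+1}\,u,$$ and replace $t$ by $t+1$. Proposition. Let $t\ge 1$. If the scheme performs at least $t$ iterations (that is, the loop condition holds at $z_0,\dots,z_{t-1}$; in particular, if it has not halted after $t$ iterations), then $$\|Pz_t\|_F^2\le\frac1t.$$ -/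

import Mathlib

/-- A Euclidean Jordan algebra with identity element: a real vector space `V` with a bilinear
commutative product `x * y` (the Jordan product `x ∘ y`), an identity element `1` (written `e` in
the literature), the Jordan identity `x ∘ (x² ∘ y) = x² ∘ (x ∘ y)` (which is `IsCommJordan`), and an
associative positive definite bilinear form. -/
class EuclideanJordanAlgebra (V : Type*) [NonAssocCommRing V] [Module ℝ V] : Prop
    extends IsCommJordan V, IsScalarTower ℝ V V, SMulCommClass ℝ V V where
  exists_form : ∃ B : LinearMap.BilinForm ℝ V,
    (∀ x : V, x ≠ 0 → 0 < B x x) ∧ ∀ x y z : V, B (x * y) z = B x (y * z)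

namespace EuclideanJordanAlgebra

noncomputable section

section Algebra

variable {V : Type*} [NonAssocCommRing V]

/-- `c` is an idempotent: `c ∘ c = c`. -/
def IsIdempotent (c : V) : Prop := c * c = c

/-- `c` is a primitive idempotent: an idempotent that is not the sum of two other idempotents
(that is, of two idempotents both different from `c`). -/
def IsPrimitiveIdempotent (c : V) : Prop :=
  IsIdempotent c ∧ ∀ a b : V, IsIdempotent a → IsIdempotent b → a + b = c → a = c ∨ b = c

/-- A Jordan frame: nonzero primitive idempotents, pairwise orthogonal, with sum `e`. -/
structure IsJordanFrame {k : ℕ} (c : Fin k → V) : Prop where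
  ne_zero : ∀ i, c i ≠ 0
  primitive : ∀ i, IsPrimitiveIdempotent (c i)
  orthogonal : ∀ i j, i ≠ j → c i * c j = 0
  sum_eq_one : ∑ i, c i = 1

/-- The powers `x⁰ = e`, `xⁿ⁺¹ = x ∘ xⁿ`. -/
def jpow (x : V) : ℕ → V
  | 0 => 1
  | n + 1 => x * jpow x n

variable (V) in
/-- The rank of `V`: the smallest `r` such that `e, x, …, x ^ r` are linearly dependent for
every `x`. -/
def rank [Module ℝ V] : ℕ :=
  sInf {r : ℕ | ∀ x : V, ¬ LinearIndependent ℝ (fun i : Fin (r + 1) => jpow x i)}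

variable [Module ℝ V]

/-- `s` is the list of eigenvalues, with multiplicity, in some spectral decomposition
`x = ∑ i, l i • c i`, where `c` is a Jordan frame. -/
def IsSpectrum (x : V) (s : Multiset ℝ) : Prop :=
  ∃ (k : ℕ) (l : Fin k → ℝ) (c : Fin k → V),
    IsJordanFrame c ∧ x = ∑ i, l i • c i ∧ s = Finset.univ.val.map l

open Classical in
/-- The eigenvalues of `x`, with multiplicity, read off a spectral decomposition of `x`.  (In a
finite-dimensional Euclidean Jordan algebra a spectral decomposition always exists and its
eigenvalues do not depend on its choice; the value `0` is a default that is never used there.) -/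
def eigenvalues (x : V) : Multiset ℝ :=
  if h : ∃ s, IsSpectrum x s then h.choose else 0

/-- The trace of `x`: the sum of its eigenvalues. -/
def trace (x : V) : ℝ := (eigenvalues x).sum

/-- The trace inner product `⟨x, y⟩ = trace (x ∘ y)`. -/
def traceInner (x y : V) : ℝ := trace (x * y)

/-- The Frobenius norm `‖x‖_F = √⟨x, x⟩`. -/
def frobNorm (x : V) : ℝ := Real.sqrt (traceInner x x)

/-- The operator norm `‖x‖`: the largest absolute value of an eigenvalue of `x`. -/
def opNorm (x : V) : ℝ := sSup {a : ℝ | ∃ l ∈ eigenvalues x, a = |l|}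

/-- `P` is the orthogonal projection onto the linear subspace `L`, relative to the trace inner
product. -/
def IsOrthogonalProjection (L : Submodule ℝ V) (P : V →ₗ[ℝ] V) : Prop :=
  ∀ x : V, P x ∈ L ∧ ∀ y ∈ L, traceInner (x - P x) y = 0

end Algebra

section Cone

variable (V : Type*) [NonAssocCommRing V] [TopologicalSpace V]

/-- `Ω`: the interior of the cone of squares. -/
def coneInterior : Set V := interior {y : V | ∃ x : V, y = x * x}

/-- The spectraplex `Δ(Ω)`: the points `x` of the closure of `Ω` with `⟨e, x⟩ = 1`. -/
def spectraplex [Module ℝ V] : Set V := {x ∈ closure (coneInterior V) | traceInner 1 x = 1}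

variable {V} [Module ℝ V]

open Classical in
/-- `v⁺`: the projection of `v` on the closure of `Ω`, that is, the point of it that is nearest to
`v` in the Frobenius norm. -/
def plus (v : V) : V :=
  if h : ∃ p ∈ closure (coneInterior V), ∀ q ∈ closure (coneInterior V),
      frobNorm (v - p) ≤ frobNorm (v - q) then h.choose else 0

/-- The condition of the while loop of the perceptron scheme: neither stopping condition
`P z ∈ Ω`, `‖(P z)⁺‖_F ≤ ‖z‖ / (4 r)` holds at `z`. -/
def LoopCondition (P : V →ₗ[ℝ] V) (z : V) : Prop :=
  P z ∉ coneInterior V ∧ 1 / (4 * (rank V : ℝ)) * opNorm z < frobNorm (plus (P z))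

/-- `z 0, …, z t` are iterates of the perceptron scheme for `P`, and the scheme has carried out (at
least) `t` iterations of its while loop: it starts at some `z 0 ∈ Δ(Ω)`, and for every `s < t` the
loop condition holds at `z s` and `z (s + 1)` comes from `z s` by a perceptron update with some
`u ∈ Δ(Ω)` such that `⟨u, P (z s)⟩ ≤ 0`. -/
structure IsPerceptronRun (P : V →ₗ[ℝ] V) (t : ℕ) (z : ℕ → V) : Prop where
  init : z 0 ∈ spectraplex V
  loop : ∀ s < t, LoopCondition P (z s)
  step : ∀ s < t, ∃ u ∈ spectraplex V, traceInner u (P (z s)) ≤ 0 ∧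
    z (s + 1) = (1 - 1 / ((s : ℝ) + 1)) • z s + (1 / ((s : ℝ) + 1)) • u

end Cone

end

end EuclideanJordanAlgebra

/-! The estimate is the perceptron argument. Write n = s + 1. Expanding `‖P z_{n+1}‖²` for the
convex combination with weights n/(n+1) and 1/(n+1), the cross term is a nonnegative multiple of
`⟨Pu, P z_n⟩ = ⟨u, P z_n⟩ ≤ 0`, and `‖Pu‖² ≤ ‖u‖² ≤ 1`. Hence n‖P z_n‖² ≤ 1 yields (n+1)²‖P
z_{n+1}‖² ≤ n + 1. The induction starts at `z_1`, which is a point of the spectraplex.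

The real work is to show that `traceInner`, defined through chosen eigenvalues, is bilinear and
positive. Power associativity (`aeval_mulLeft_mul`) and self-adjointness of multiplications give a
spectral theorem (`exists_isJordanFrame`). Linearity of the trace comes from a functional equal to 1
on all nonzero primitive idempotents (`exists_linear_trace`). The given form `B` may scale simple
summands differently, but non-orthogonal primitive idempotents have equal `B`-length
(`form_self_eq_of_form_ne_zero`), so its scale can be divided out length by length. -/

namespace EuclideanJordanAlgebra

open Polynomial

/-! ### Diagonalisation of symmetric operators. -/

/-- A symmetric operator is annihilated by a polynomial with simple real roots. -/
theorem exists_aeval_nodal_eq_zero {E : Type*} [AddCommGroup E] [Module ℝ E]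
    [FiniteDimensional ℝ E] (B : LinearMap.BilinForm ℝ E) (hpos : ∀ x : E, x ≠ 0 → 0 < B x x)
    (hsymm : ∀ x y, B x y = B y x) (T : E →ₗ[ℝ] E) (hT : ∀ x y, B (T x) y = B x (T y)) :
    ∃ S : Finset ℝ, aeval T (Lagrange.nodal S id) = 0 := by
  let core : InnerProductSpace.Core ℝ E :=
    { inner := fun x y => B x y
      conj_inner_symm := fun x y => by simpa using hsymm y x
      re_inner_nonneg := fun x => by
        by_cases hx : x = 0
        · simp [hx]
        · simpa using (hpos x hx).le
      add_left := fun x y z => by simp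
      smul_left := fun x y r => by simp
      definite := fun x hx => by
        by_contra h
        exact (hpos x h).ne' hx }
  let _ : NormedAddCommGroup E := core.toNormedAddCommGroup
  let _ : InnerProductSpace ℝ E := InnerProductSpace.ofCore core.toCore
  have hsym : T.IsSymmetric := fun x y => hT x y
  -- Passing to the finite set of eigenvalues discards multiplicities, so the roots are simple.
  refine ⟨Finset.univ.image (hsym.eigenvalues rfl), ?_⟩
  refine (hsym.eigenvectorBasis rfl).toBasis.ext fun i => ?_
  have h1 := hsym.hasEigenvector_eigenvectorBasis rfl i
  have h2 := Module.End.aeval_apply_of_hasEigenvector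
    (p := Lagrange.nodal (Finset.univ.image (hsym.eigenvalues rfl)) id) h1
  rw [OrthonormalBasis.coe_toBasis, h2, LinearMap.zero_apply]
  have : Polynomial.eval (hsym.eigenvalues rfl i)
      (Lagrange.nodal (Finset.univ.image (hsym.eigenvalues rfl)) id) = 0 :=
    Lagrange.eval_nodal_at_node (v := id) (Finset.mem_image_of_mem _ (Finset.mem_univ i))
  simp only [RCLike.ofReal_real_eq_id, id_eq] at *
  rw [this, zero_smul]

/-! ### Power associativity and Peirce relations from the linearized Jordan identity. -/

section Jordan

variable {V : Type*} [NonAssocCommRing V] [Module ℝ V] [EuclideanJordanAlgebra V]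

/-- The fully linearized Jordan identity. -/
theorem linearized_jordan (a b c y : V) :
    a * ((b * c) * y) - (b * c) * (a * y) + (b * ((c * a) * y) - (c * a) * (b * y)) +
      (c * ((a * b) * y) - (a * b) * (c * y)) = 0 := by
  have h := DFunLike.congr_fun (two_nsmul_lie_lmul_lmul_add_add_eq_zero a b c) y
  have h2 : (2 : ℝ) • (a * ((b * c) * y) - (b * c) * (a * y) +
      (b * ((c * a) * y) - (c * a) * (b * y)) +
      (c * ((a * b) * y) - (a * b) * (c * y))) = 0 := by
    rw [ofNat_smul_eq_nsmul]; exact h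
  exact (smul_eq_zero.mp h2).resolve_left two_ne_zero

theorem mul_sq_mul (x y : V) : x * ((x * x) * y) = (x * x) * (x * y) := by
  have h := linearized_jordan x x x y
  have h3 : (3 : ℝ) • (x * ((x * x) * y) - (x * x) * (x * y)) = 0 := by
    rw [← h]; module
  exact sub_eq_zero.mp ((smul_eq_zero.mp h3).resolve_left three_ne_zero)

/-- Read as an identity of operators in z, this expresses multiplication by x²∘y through
multiplications by x², y, x∘y and x; it drives the recursion on powers. -/
theorem sq_mul_mul (x y z : V) : (x * x) * y * z =
    (x * x) * (y * z) + (2 : ℝ) • ((x * y) * (x * z)) - (2 : ℝ) • (x * (y * (x * z))) := by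
  have h := linearized_jordan x x z y
  rw [mul_comm ((x * x) * y) z, mul_comm y z, mul_comm (x * y) (x * z), mul_comm y (x * z)]
  rw [mul_comm z x] at h
  rw [← sub_eq_zero, ← h]
  module

/-- Since xⁿ⁺² = x²∘xⁿ, `sq_mul_mul` writes multiplication by xⁿ⁺² in terms of multiplications by
x², xⁿ, xⁿ⁺¹ and x, all of which already commute with multiplication by x. -/
theorem commute_mulLeft_pow (x : V) (n : ℕ) :
    Commute (LinearMap.mulLeft ℝ ((LinearMap.mulLeft ℝ x ^ n) 1)) (LinearMap.mulLeft ℝ x) := by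
  have hsq : Commute (LinearMap.mulLeft ℝ (x * x)) (LinearMap.mulLeft ℝ x) := by
    ext y
    simpa using (mul_sq_mul x y).symm
  induction n using Nat.twoStepInduction with
  | zero =>
    ext y
    simp
  | one => simp
  | more n h1 h2 =>
    have hx : (LinearMap.mulLeft ℝ x ^ (n + 2)) 1 =
        (x * x) * ((LinearMap.mulLeft ℝ x ^ n) 1) := by
      have h := DFunLike.congr_fun (hsq.pow_right n) 1
      simp only [Module.End.mul_apply, LinearMap.mulLeft_apply, mul_one] at h
      rw [h, pow_add, Module.End.mul_apply]
      simp [pow_two]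
    have key : LinearMap.mulLeft ℝ ((LinearMap.mulLeft ℝ x ^ (n + 2)) 1) =
        LinearMap.mulLeft ℝ (x * x) * LinearMap.mulLeft ℝ ((LinearMap.mulLeft ℝ x ^ n) 1) +
        (2 : ℝ) • (LinearMap.mulLeft ℝ ((LinearMap.mulLeft ℝ x ^ (n + 1)) 1) *
          LinearMap.mulLeft ℝ x) -
        (2 : ℝ) • (LinearMap.mulLeft ℝ x * LinearMap.mulLeft ℝ ((LinearMap.mulLeft ℝ x ^ n) 1) *
          LinearMap.mulLeft ℝ x) := by
      ext z
      rw [hx, pow_succ' _ n]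
      simpa using sq_mul_mul x ((LinearMap.mulLeft ℝ x ^ n) 1) z
    rw [key]
    exact ((hsq.mul_left h1).add_left ((h2.mul_left rfl).smul_left 2)).sub_left
      ((((Commute.refl _).mul_left h1).mul_left rfl).smul_left 2)

theorem commute_mulLeft_aeval (x : V) (f : ℝ[X]) :
    Commute (LinearMap.mulLeft ℝ (aeval (LinearMap.mulLeft ℝ x) f 1)) (LinearMap.mulLeft ℝ x) := by
  induction f using Polynomial.induction_on' with
  | add p q hp hq =>
    have : LinearMap.mulLeft ℝ (aeval (LinearMap.mulLeft ℝ x) (p + q) 1) =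
        LinearMap.mulLeft ℝ (aeval (LinearMap.mulLeft ℝ x) p 1) +
        LinearMap.mulLeft ℝ (aeval (LinearMap.mulLeft ℝ x) q 1) := by
      ext z; simp [add_mul]
    rw [this]
    exact hp.add_left hq
  | monomial n a =>
    have : LinearMap.mulLeft ℝ (aeval (LinearMap.mulLeft ℝ x) (monomial n a) 1) =
        a • LinearMap.mulLeft ℝ ((LinearMap.mulLeft ℝ x ^ n) 1) := by
      ext z
      rw [aeval_monomial, ← Algebra.smul_def]
      simp [smul_mul_assoc]
    rw [this]
    exact (commute_mulLeft_pow x n).smul_left a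

/-- Power associativity: evaluation of polynomials at `x` is multiplicative. -/
theorem aeval_mulLeft_mul (x : V) (f g : ℝ[X]) :
    aeval (LinearMap.mulLeft ℝ x) f 1 * aeval (LinearMap.mulLeft ℝ x) g 1 =
      aeval (LinearMap.mulLeft ℝ x) (f * g) 1 := by
  have h : Commute (LinearMap.mulLeft ℝ (aeval (LinearMap.mulLeft ℝ x) f 1))
      (aeval (LinearMap.mulLeft ℝ x) g) := by
    induction g using Polynomial.induction_on' with
    | add p q hp hq => rw [map_add]; exact hp.add_right hq
    | monomial n a =>
      rw [aeval_monomial, ← Algebra.smul_def]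
      exact ((commute_mulLeft_aeval x f).pow_right n).smul_right a
  have h2 := DFunLike.congr_fun h 1
  simp only [Module.End.mul_apply, LinearMap.mulLeft_apply, mul_one] at h2
  rw [h2, mul_comm f g, map_mul, Module.End.mul_apply]

/-! ### Peirce relations -/

theorem mul_mul_eq_of_mul_eq_self {c x : V} (hc : c * c = c) (hx : c * x = x) (y : V) :
    c * (x * y) = x * (c * y) := by
  have h := linearized_jordan c c x y
  rw [hc, hx, mul_comm x c, hx] at h
  rw [← sub_eq_zero, ← h]
  module

theorem mul_mul_eq_of_mul_eq_zero {c x : V} (hc : c * c = c) (hx : c * x = 0) (y : V) :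
    c * (x * y) = x * (c * y) := by
  have h := linearized_jordan c c x y
  rw [hc, hx, mul_comm x c, hx] at h
  simp only [zero_mul, mul_zero, sub_zero, zero_add] at h
  exact (sub_eq_zero.mp h).symm

/-- Multiplication by c commutes with multiplication by x and by y, so c∘(x∘y) equals both x∘(c∘y) =
0 and y∘(c∘x) = x∘y. -/
theorem mul_eq_zero_of_mul_eq_self {c x y : V} (hc : c * c = c) (hx : c * x = x)
    (hy : c * y = 0) : x * y = 0 := by
  have h1 := mul_mul_eq_of_mul_eq_self hc hx y
  have h2 := mul_mul_eq_of_mul_eq_zero hc hy x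
  rw [hy, mul_zero] at h1
  rw [hx, mul_comm y x, h1] at h2
  exact h2.symm

/-- Multiplication by an idempotent is a root of t(2t − 1)(t − 1); its only possible eigenvalues are
0, 1/2 and 1. -/
theorem peirce_identity {c : V} (hc : c * c = c) (x : V) :
    (2 : ℝ) • (c * (c * (c * x))) = (3 : ℝ) • (c * (c * x)) - c * x := by
  have h := linearized_jordan c c x c
  rw [hc, mul_comm x c, mul_comm (c * x) c, hc, mul_comm x c] at h
  rw [← sub_eq_zero, ← h]
  module

end Jordan

/-! ### Spectral decomposition into orthogonal idempotents. -/

section Spectral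

variable {V : Type*} [NonAssocCommRing V] [Module ℝ V]

theorem form_symm {B : LinearMap.BilinForm ℝ V} (hB : ∀ x y z : V, B (x * y) z = B x (y * z))
    (x y : V) : B x y = B y x := by
  rw [← one_mul x, hB, mul_comm x y, ← hB, one_mul, one_mul]

theorem form_self_nonneg {B : LinearMap.BilinForm ℝ V} (hpos : ∀ x : V, x ≠ 0 → 0 < B x x)
    (x : V) : 0 ≤ B x x := by
  by_cases hx : x = 0
  · simp [hx]
  · exact (hpos x hx).le

variable [EuclideanJordanAlgebra V]

/-- Multiplication by an idempotent is a sum of squares of self-adjoint operators. -/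
theorem form_idempotent_mul_self {B : LinearMap.BilinForm ℝ V}
    (hB : ∀ x y z : V, B (x * y) z = B x (y * z)) {c : V} (hc : c * c = c) (x : V) :
    B (c * x) x = B (c * x) (c * x) +
      4 * B (c * x - c * (c * x)) (c * x - c * (c * x)) := by
  -- With T multiplication by c, the claim is T = T² + 4(T − T²)², which holds at each of the roots
  -- 0, 1/2, 1.
  have hL : ∀ x y, B (c * x) y = B x (c * y) := fun x y => by rw [mul_comm c x, hB]
  have h1 : (2 : ℝ) * B (c * (c * (c * x))) x = 3 * B (c * (c * x)) x - B (c * x) x := by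
    have := congrArg (fun v => B v x) (peirce_identity hc x)
    simpa using this
  have h2 : (2 : ℝ) * B (c * (c * (c * (c * x)))) x =
      3 * B (c * (c * (c * x))) x - B (c * (c * x)) x := by
    have := congrArg (fun v => B v x) (peirce_identity hc (c * x))
    simpa using this
  have e1 : B (c * x) (c * x) = B (c * (c * x)) x := by rw [hL (c * x) x]
  have e2 : B (c * x) (c * (c * x)) = B (c * (c * (c * x))) x := by
    rw [hL (c * (c * x)) x, hL (c * x) (c * x)]
  have e3 : B (c * (c * x)) (c * x) = B (c * (c * (c * x))) x := by rw [hL (c * (c * x)) x]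
  have e4 : B (c * (c * x)) (c * (c * x)) = B (c * (c * (c * (c * x)))) x := by
    rw [hL (c * (c * (c * x))) x, hL (c * (c * x)) (c * x)]
  simp only [map_sub, LinearMap.sub_apply, e1, e2, e3, e4]
  linarith

theorem form_idempotent_mul_self_nonneg {B : LinearMap.BilinForm ℝ V}
    (hpos : ∀ x : V, x ≠ 0 → 0 < B x x) (hB : ∀ x y z : V, B (x * y) z = B x (y * z))
    {c : V} (hc : c * c = c) (x : V) : 0 ≤ B (c * x) x := by
  rw [form_idempotent_mul_self hB hc]
  have := form_self_nonneg hpos (c * x)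
  have := form_self_nonneg hpos (c * x - c * (c * x))
  positivity

theorem mul_eq_zero_of_form_eq_zero {B : LinearMap.BilinForm ℝ V}
    (hpos : ∀ x : V, x ≠ 0 → 0 < B x x) (hB : ∀ x y z : V, B (x * y) z = B x (y * z))
    {c x : V} (hc : c * c = c) (h : B (c * x) x = 0) : c * x = 0 := by
  by_contra hne
  rw [form_idempotent_mul_self hB hc] at h
  have := hpos _ hne
  have := form_self_nonneg hpos (c * x - c * (c * x))
  linarith

/-- A complete system of nonzero orthogonal idempotents. -/
structure IsIdempotentSystem (S : Finset V) : Prop where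
  ne_zero : ∀ c ∈ S, c ≠ 0
  idem : ∀ c ∈ S, c * c = c
  orthogonal : ∀ c ∈ S, ∀ d ∈ S, c ≠ d → c * d = 0
  sum_eq_one : ∑ c ∈ S, c = 1

theorem IsIdempotentSystem.sum_smul_mul {S : Finset V} (hS : IsIdempotentSystem S) (l : V → ℝ)
    {c : V} (hc : c ∈ S) : (∑ d ∈ S, l d • d) * c = l c • c := by
  rw [Finset.sum_mul, Finset.sum_eq_single_of_mem c hc, smul_mul_assoc, hS.idem c hc]
  intro d hd hdc
  rw [smul_mul_assoc, hS.orthogonal d hd c hc hdc, smul_zero]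

variable [FiniteDimensional ℝ V]

/-- Multiplication by x is `B`-symmetric, hence killed by a polynomial with simple real roots. The
Lagrange basis polynomials at these roots, evaluated at x, are orthogonal idempotents by power
associativity, and interpolating 1 and X gives the sums 1 and x. -/
theorem exists_isIdempotentSystem (x : V) :
    ∃ S : Finset V, IsIdempotentSystem S ∧ x ∈ Submodule.span ℝ (S : Set V) := by
  classical
  obtain ⟨B, hpos, hB⟩ := exists_form (V := V)
  set T := LinearMap.mulLeft ℝ x with hT
  obtain ⟨N, hN⟩ := exists_aeval_nodal_eq_zero B hpos (form_symm hB) T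
    (fun y z => by simp only [hT, LinearMap.mulLeft_apply]; rw [mul_comm x y, hB])
  have hker : ∀ p : ℝ[X], (∀ s ∈ N, p.eval s = 0) → aeval T p = 0 := by
    intro p hp
    have hdvd : Lagrange.nodal N id ∣ p := by
      refine Finset.prod_dvd_of_coprime ?_ fun s hs => dvd_iff_isRoot.mpr (hp s hs)
      exact fun a _ b _ hab => pairwise_coprime_X_sub_C Function.injective_id hab
    obtain ⟨q, rfl⟩ := hdvd
    rw [map_mul, hN, zero_mul]
  set v : ℝ → V := fun s => aeval T (Lagrange.basis N id s) 1 with hv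
  have hexp : ∀ p : ℝ[X], aeval T p 1 = ∑ s ∈ N, p.eval s • v s := by
    intro p
    have h0 := hker (p - ∑ s ∈ N, C (p.eval s) * Lagrange.basis N id s) (by
      intro t ht
      rw [eval_sub, eval_finsetSum, Finset.sum_eq_single_of_mem t ht]
      · have := Lagrange.eval_basis_self (v := id) Function.injective_id.injOn ht
        simp only [id_eq] at this
        simp [this]
      · intro s hs hst
        have := Lagrange.eval_basis_of_ne (v := id) hst ht
        simp only [id_eq] at this
        simp [this])
    rw [map_sub, sub_eq_zero] at h0
    rw [h0, map_sum, LinearMap.sum_apply]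
    refine Finset.sum_congr rfl fun s _ => ?_
    rw [C_mul', map_smul, LinearMap.smul_apply]
  have horth : ∀ s ∈ N, ∀ t ∈ N, s ≠ t → v s * v t = 0 := by
    intro s _ t _ hst
    simp only [hv, hT, aeval_mulLeft_mul]
    rw [hker _ _, LinearMap.zero_apply]
    intro u hu
    rw [eval_mul]
    by_cases h : s = u
    · have := Lagrange.eval_basis_of_ne (v := id) (s := N) (i := t) (j := u)
        (fun h' => hst (h.trans h'.symm)) hu
      simp only [id_eq] at this
      rw [this, mul_zero]
    · have := Lagrange.eval_basis_of_ne (v := id) (s := N) h hu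
      simp only [id_eq] at this
      rw [this, zero_mul]
  have hsum : ∑ s ∈ N, v s = 1 := by
    have := hexp 1
    simpa using this.symm
  have hidem : ∀ s ∈ N, v s * v s = v s := by
    intro s hs
    have h := mul_one (v s)
    rwa [← hsum, Finset.mul_sum, Finset.sum_eq_single_of_mem s hs
      fun t ht hts => horth s hs t ht hts.symm] at h
  have hx : x = ∑ s ∈ N, s • v s := by
    have := hexp X
    simpa [hT] using this
  have hinj : Set.InjOn v ((N.filter fun s => v s ≠ 0 : Finset ℝ) : Set ℝ) := by
    intro s hs t ht hst
    simp only [Finset.coe_filter, Set.mem_ofPred_eq] at hs ht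
    by_contra hne
    have := horth s hs.1 t ht.1 hne
    rw [← hst, hidem s hs.1] at this
    exact hs.2 this
  -- An eigenvalue of multiplication by x need not be an eigenvalue of x; at such a node `v s = 0`.
  refine ⟨(N.filter fun s => v s ≠ 0).image v, ⟨?_, ?_, ?_, ?_⟩, ?_⟩
  · simp only [Finset.mem_image, Finset.mem_filter]
    rintro _ ⟨s, hs, rfl⟩
    exact hs.2
  · simp only [Finset.mem_image, Finset.mem_filter]
    rintro _ ⟨s, hs, rfl⟩
    exact hidem s hs.1
  · simp only [Finset.mem_image, Finset.mem_filter]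
    rintro _ ⟨s, hs, rfl⟩ _ ⟨t, ht, rfl⟩ hst
    exact horth s hs.1 t ht.1 fun h => hst (by rw [h])
  · rw [Finset.sum_image hinj, Finset.sum_filter_ne_zero, hsum]
  · rw [hx]
    refine Submodule.sum_mem _ fun s hs => Submodule.smul_mem _ _ ?_
    by_cases h : v s = 0
    · rw [h]; exact Submodule.zero_mem _
    · exact Submodule.subset_span (Finset.mem_coe.mpr
        (Finset.mem_image_of_mem v (Finset.mem_filter.mpr ⟨hs, h⟩)))

/-- The Peirce one-space of a primitive idempotent is a line. -/
theorem IsPrimitiveIdempotent.exists_eq_smul {c x : V} (hc : IsPrimitiveIdempotent c)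
    (hx : c * x = x) : ∃ a : ℝ, x = a • c := by
  obtain ⟨B, hpos, hB⟩ := exists_form (V := V)
  obtain ⟨S, hS, hxS⟩ := exists_isIdempotentSystem x
  obtain ⟨l, -, hl⟩ := Submodule.mem_span_finset.mp hxS
  have hcc : c * c = c := hc.1
  have hd : (1 - c) * (1 - c) = 1 - c := by
    rw [mul_sub, sub_mul, sub_mul, hcc]; simp
  have hxd : x * (1 - c) = 0 := by rw [mul_sub, mul_one, mul_comm, hx, sub_self]
  have hxx : x * x = ∑ v ∈ S, (l v * l v) • v := by
    nth_rw 2 [← hl]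
    rw [Finset.mul_sum]
    refine Finset.sum_congr rfl fun v hv => ?_
    rw [mul_smul_comm, ← hl, hS.sum_smul_mul l hv, smul_smul]
  have hBv : ∀ v ∈ S, B v (1 - c) = B ((1 - c) * v) v := by
    intro v hv
    rw [hB, hS.idem v hv, form_symm hB]
  -- Pairing x² with 1 − c gives zero as a sum of nonnegative terms. Each v with nonzero coefficient
  -- thus satisfies c∘v = v, and primitivity applied to c = v + (c − v) forces v = c.
  have h0 : ∑ v ∈ S, l v * l v * B v (1 - c) = 0 := by
    have : B (x * x) (1 - c) = 0 := by rw [hB, hxd, map_zero]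
    rw [hxx] at this
    simpa using this
  have hmem : x ∈ Submodule.span ℝ {c} := by
    rw [← hl]
    refine Submodule.sum_mem _ fun v hv => ?_
    by_cases hlv : l v = 0
    · rw [hlv, zero_smul]; exact Submodule.zero_mem _
    refine Submodule.smul_mem _ _ ?_
    have hz := (Finset.sum_eq_zero_iff_of_nonneg (fun v hv => mul_nonneg (mul_self_nonneg (l v))
      (by rw [hBv v hv]; exact form_idempotent_mul_self_nonneg hpos hB hd v))).mp h0 v hv
    rw [hBv v hv] at hz
    have hz' := mul_eq_zero_of_form_eq_zero hpos hB hd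
      ((mul_eq_zero.mp hz).resolve_left (mul_ne_zero hlv hlv))
    have hcv : c * v = v := by
      rw [sub_mul, one_mul, sub_eq_zero] at hz'
      exact hz'.symm
    have hcv' : IsIdempotent (c - v) := by
      unfold IsIdempotent
      rw [mul_sub, sub_mul, sub_mul, hcc, mul_comm v c, hcv, hS.idem v hv]; simp
    rcases hc.2 v (c - v) (hS.idem v hv) hcv' (by abel) with h | h
    · rw [h]; exact Submodule.mem_span_singleton_self c
    · exact absurd (by simpa using h) (hS.ne_zero v hv)
  obtain ⟨a, ha⟩ := Submodule.mem_span_singleton.mp hmem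
  exact ⟨a, ha.symm⟩

end Spectral

/-! ### Jordan frames and linearity of the trace. -/

section Trace

variable {V : Type*} [NonAssocCommRing V] [Module ℝ V]

theorem sum_smul_isJordanFrame {τ : V →ₗ[ℝ] ℝ}
    (hτ : ∀ c : V, IsPrimitiveIdempotent c → c ≠ 0 → τ c = 1) {k : ℕ} {c : Fin k → V}
    (hc : IsJordanFrame c) (l : Fin k → ℝ) : τ (∑ i, l i • c i) = ∑ i, l i := by
  rw [map_sum]
  refine Finset.sum_congr rfl fun i _ => ?_
  rw [map_smul, hτ _ (hc.primitive i) (hc.ne_zero i), smul_eq_mul, mul_one]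

variable [EuclideanJordanAlgebra V]

theorem IsIdempotentSystem.linearIndepOn {S : Finset V} (hS : IsIdempotentSystem S) :
    LinearIndepOn ℝ id (S : Set V) := by
  rw [linearIndepOn_finset_iff]
  intro g hg c hc
  have h := hS.sum_smul_mul g hc
  simp only [id_eq] at hg
  rw [hg, zero_mul] at h
  exact (smul_eq_zero.mp h.symm).resolve_right (hS.ne_zero c hc)

/-- Split c = a + b. Squaring gives a∘b = 0, so a and b lie in the Peirce one-space of c, which
annihilates the zero-space containing the other members. -/
theorem IsIdempotentSystem.exists_split {S : Finset V} (hS : IsIdempotentSystem S) {c : V}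
    (hc : c ∈ S) (hcp : ¬ IsPrimitiveIdempotent c) :
    ∃ S' : Finset V, IsIdempotentSystem S' ∧ S'.card = S.card + 1 ∧
      (S : Set V) ⊆ Submodule.span ℝ (S' : Set V) := by
  classical
  have hcc : c * c = c := hS.idem c hc
  simp only [IsPrimitiveIdempotent, not_and, not_forall, not_or, exists_prop] at hcp
  obtain ⟨a, b, ha, hb, hab, hac, hbc⟩ := hcp hcc
  unfold IsIdempotent at ha hb
  have ha0 : a ≠ 0 := by rintro rfl; exact hbc (by simpa using hab)
  have hb0 : b ≠ 0 := by rintro rfl; exact hac (by simpa using hab)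
  have hab0 : a * b = 0 := by
    have h2 : (2 : ℝ) • (a * b) = 0 := by
      have h := hcc
      rw [← hab, mul_add, add_mul, add_mul, ha, hb, mul_comm b a] at h
      rw [← sub_eq_zero] at h
      rw [← h]
      module
    exact (smul_eq_zero.mp h2).resolve_left two_ne_zero
  have hca : c * a = a := by rw [← hab, add_mul, ha, mul_comm, hab0, add_zero]
  have hcb : c * b = b := by rw [← hab, add_mul, hb, hab0, zero_add]
  have hne : a ≠ b := by
    rintro rfl
    exact ha0 (ha.symm.trans hab0)
  have had : ∀ d ∈ S.erase c, a * d = 0 := fun d hd =>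
    mul_eq_zero_of_mul_eq_self hcc hca
      (hS.orthogonal c hc d (Finset.mem_of_mem_erase hd) (Finset.ne_of_mem_erase hd).symm)
  have hbd : ∀ d ∈ S.erase c, b * d = 0 := fun d hd =>
    mul_eq_zero_of_mul_eq_self hcc hcb
      (hS.orthogonal c hc d (Finset.mem_of_mem_erase hd) (Finset.ne_of_mem_erase hd).symm)
  have haS : a ∉ S.erase c := fun h => ha0 (ha.symm.trans (had a h))
  have hbS : b ∉ S.erase c := fun h => hb0 (hb.symm.trans (hbd b h))
  have haS' : a ∉ insert b (S.erase c) := by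
    rw [Finset.mem_insert, not_or]; exact ⟨hne, haS⟩
  refine ⟨insert a (insert b (S.erase c)), ⟨?_, ?_, ?_, ?_⟩, ?_, ?_⟩
  · intro d hd
    rcases Finset.mem_insert.mp hd with rfl | hd
    · exact ha0
    rcases Finset.mem_insert.mp hd with rfl | hd
    · exact hb0
    exact hS.ne_zero d (Finset.mem_of_mem_erase hd)
  · intro d hd
    rcases Finset.mem_insert.mp hd with rfl | hd
    · exact ha
    rcases Finset.mem_insert.mp hd with rfl | hd
    · exact hb
    exact hS.idem d (Finset.mem_of_mem_erase hd)
  · intro d hd d' hd' hdd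
    simp only [Finset.mem_insert] at hd hd'
    rcases hd with rfl | rfl | hd <;> rcases hd' with rfl | rfl | hd'
    · exact absurd rfl hdd
    · exact hab0
    · exact had _ hd'
    · rw [mul_comm]; exact hab0
    · exact absurd rfl hdd
    · exact hbd _ hd'
    · rw [mul_comm]; exact had _ hd
    · rw [mul_comm]; exact hbd _ hd
    · exact hS.orthogonal d (Finset.mem_of_mem_erase hd) d' (Finset.mem_of_mem_erase hd') hdd
  · rw [Finset.sum_insert haS', Finset.sum_insert hbS, ← add_assoc, hab,
      Finset.add_sum_erase S (fun d => d) hc, hS.sum_eq_one]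
  · rw [Finset.card_insert_of_notMem haS', Finset.card_insert_of_notMem hbS,
      Finset.card_erase_add_one hc]
  · intro d hd
    by_cases hdc : d = c
    · rw [hdc, ← hab]
      exact Submodule.add_mem _ (Submodule.subset_span (by simp)) (Submodule.subset_span (by simp))
    · exact Submodule.subset_span (by simpa [hdc] using Or.inr (Or.inr hd))

theorem mul_self_isJordanFrame {k : ℕ} {c : Fin k → V} (hc : IsJordanFrame c) (l : Fin k → ℝ) :
    (∑ i, l i • c i) * (∑ i, l i • c i) = ∑ i, (l i ^ 2) • c i := by
  rw [Finset.mul_sum]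
  refine Finset.sum_congr rfl fun i _ => ?_
  rw [Finset.sum_mul, Finset.sum_eq_single_of_mem i (Finset.mem_univ i)]
  · rw [smul_mul_smul_comm, (hc.primitive i).1, pow_two]
  · intro j _ hji
    rw [smul_mul_smul_comm, hc.orthogonal j i hji, smul_zero]

variable [FiniteDimensional ℝ V]

theorem IsIdempotentSystem.card_le_finrank {S : Finset V} (hS : IsIdempotentSystem S) :
    S.card ≤ Module.finrank ℝ V := by
  have h : LinearIndependent ℝ (fun c : S => (c : V)) := hS.linearIndepOn
  simpa using h.fintype_card_le_finrank

/-- Orthogonal nonzero idempotents are independent, so at most n further splittings fit into the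
dimension. -/
theorem IsIdempotentSystem.exists_primitive_refinement (n : ℕ) :
    ∀ S : Finset V, IsIdempotentSystem S → Module.finrank ℝ V ≤ S.card + n →
      ∃ S' : Finset V, IsIdempotentSystem S' ∧ (∀ c ∈ S', IsPrimitiveIdempotent c) ∧
        (S : Set V) ⊆ Submodule.span ℝ (S' : Set V) := by
  induction n with
  | zero =>
    intro S hS hn
    refine ⟨S, hS, fun c hc => ?_, Submodule.subset_span⟩
    by_contra hcp
    obtain ⟨S', hS', hcard, -⟩ := hS.exists_split hc hcp
    have := hS'.card_le_finrank
    omega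
  | succ n ih =>
    intro S hS hn
    by_cases h : ∀ c ∈ S, IsPrimitiveIdempotent c
    · exact ⟨S, hS, h, Submodule.subset_span⟩
    push Not at h
    obtain ⟨c, hc, hcp⟩ := h
    obtain ⟨S', hS', hcard, hsub⟩ := hS.exists_split hc hcp
    obtain ⟨S'', hS'', hprim, hsub'⟩ := ih S' hS' (by omega)
    exact ⟨S'', hS'', hprim, hsub.trans (Submodule.span_le.mpr hsub')⟩

/-- The spectral theorem: every element is a combination of a Jordan frame. -/
theorem exists_isJordanFrame (x : V) :
    ∃ (k : ℕ) (l : Fin k → ℝ) (c : Fin k → V), IsJordanFrame c ∧ x = ∑ i, l i • c i := by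
  obtain ⟨S, hS, hxS⟩ := exists_isIdempotentSystem x
  obtain ⟨S', hS', hprim, hsub⟩ := IsIdempotentSystem.exists_primitive_refinement _ S hS
    (Nat.le_add_left _ _)
  obtain ⟨l, -, hl⟩ := Submodule.mem_span_finset.mp (Submodule.span_le.mpr hsub hxS)
  have hsum : ∀ f : V → V, ∑ i, f (S'.equivFin.symm i) = ∑ c ∈ S', f c := fun f => by
    rw [Equiv.sum_comp S'.equivFin.symm (fun c : S' => f c), Finset.sum_coe_sort S' f]
  refine ⟨S'.card, fun i => l (S'.equivFin.symm i), fun i => S'.equivFin.symm i,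
    ⟨fun i => hS'.ne_zero _ (S'.equivFin.symm i).2, fun i => hprim _ (S'.equivFin.symm i).2,
      fun i j hij => hS'.orthogonal _ (S'.equivFin.symm i).2 _ (S'.equivFin.symm j).2
        fun h => hij (S'.equivFin.symm.injective (Subtype.ext h)), ?_⟩, ?_⟩
  · rw [hsum fun c => c, hS'.sum_eq_one]
  · rw [hsum fun c => l c • c, hl]

/-- Non-orthogonal primitive idempotents have the same length for every associative form. -/
theorem form_self_eq_of_form_ne_zero {B : LinearMap.BilinForm ℝ V}
    (hB : ∀ x y z : V, B (x * y) z = B x (y * z)) {c d : V} (hc : IsPrimitiveIdempotent c)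
    (hd : IsPrimitiveIdempotent d) (hcd : B c d ≠ 0) : B c c = B d d := by
  -- The polynomial 2t² − t is 0, 0, 1 at 0, 1/2, 1, so it projects onto the Peirce one-space of c,
  -- a line.
  have key : ∀ {c d : V}, IsPrimitiveIdempotent c →
      ∃ a : ℝ, (2 : ℝ) • (c * (c * d)) - c * d = a • c ∧ B c d = a * B c c := by
    intro c d hc
    have hcc : c * c = c := hc.1
    have h1 : c * ((2 : ℝ) • (c * (c * d)) - c * d) = (2 : ℝ) • (c * (c * d)) - c * d := by
      rw [mul_sub, mul_smul_comm, peirce_identity hcc]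
      module
    obtain ⟨a, ha⟩ := hc.exists_eq_smul h1
    refine ⟨a, ha, ?_⟩
    have h2 : B (c * d) c = B c d := by rw [mul_comm, hB, hcc, form_symm hB]
    have h3 : B (c * (c * d)) c = B c d := by rw [mul_comm, hB, hcc, h2]
    have h4 := congrArg (fun v => B v c) ha
    simp only [map_sub, map_smul, LinearMap.sub_apply, LinearMap.smul_apply, smul_eq_mul, h2,
      h3] at h4
    linarith
  have prod : ∀ {c d : V} {a b : ℝ}, c * c = c → d * d = d →
      (2 : ℝ) • (c * (c * d)) - c * d = a • c → (2 : ℝ) • (d * (c * d)) - c * d = b • d →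
      (c * d) * (c * d) = (b / 2) • (c * d) + (a / 4) • c + (b / 4) • d := by
    intro c d a b hcc hdd h1 h2
    have h1' : c * (c * d) = (1 / 2 : ℝ) • (a • c + c * d) := by rw [← h1]; module
    have h2' : d * (c * d) = (1 / 2 : ℝ) • (b • d + c * d) := by rw [← h2]; module
    have h := linearized_jordan c c d d
    rw [hcc, mul_comm d c, hdd, mul_comm (c * d) d, h2'] at h
    simp only [mul_smul_comm, mul_add, h1'] at h
    rw [← sub_eq_zero]
    refine (smul_eq_zero_iff_right (show (-2 : ℝ) ≠ 0 by norm_num)).mp ?_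
    rw [← h]
    module
  obtain ⟨a, h1, ha⟩ := key (d := d) hc
  obtain ⟨b, h2, hb⟩ := key (d := c) hd
  have hp := prod hc.1 hd.1 h1 (by rwa [mul_comm d c] at h2)
  have hp' := prod hd.1 hc.1 h2 (by rwa [mul_comm c d] at h1)
  -- The square of c∘d is computed twice, with the roles of c and d exchanged; comparison leaves (b
  -- − a)/2 times c∘d.
  rw [mul_comm d c, hp] at hp'
  have hz : ((b - a) / 2) • (c * d) = 0 := by
    rw [← sub_eq_zero] at hp'
    rw [← hp']
    module
  have hcd0 : c * d ≠ 0 := fun h => hcd (by rw [← mul_one d, ← hB, h]; simp)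
  have hab : b = a := by
    have := (smul_eq_zero.mp hz).resolve_right hcd0
    linarith
  rw [form_symm hB d c, hab] at hb
  have ha0 : a ≠ 0 := by rintro rfl; exact hcd (by rw [ha, zero_mul])
  exact mul_left_cancel₀ ha0 (ha.symm.trans hb)

variable (V) in
/-- There is a linear functional which is `1` at every nonzero primitive idempotent. -/
theorem exists_linear_trace :
    ∃ τ : V →ₗ[ℝ] ℝ, ∀ c : V, IsPrimitiveIdempotent c → c ≠ 0 → τ c = 1 := by
  classical
  obtain ⟨B, hpos, hB⟩ := exists_form (V := V)
  let I := {c : V // IsPrimitiveIdempotent c ∧ c ≠ 0}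
  let lc : (I →₀ ℝ) →ₗ[ℝ] V := Finsupp.linearCombination ℝ Subtype.val
  let sm : (I →₀ ℝ) →ₗ[ℝ] ℝ := Finsupp.linearCombination ℝ fun _ => 1
  -- The coefficient sum must descend from formal combinations of primitive idempotents to V. A
  -- relation is grouped by `B`-length β: groups of different length are orthogonal, so each group w
  -- vanishes, and B(w, 1) is β times its coefficient sum.
  have hker : ∀ f, lc f = 0 → sm f = 0 := by
    intro f hf
    simp only [lc, sm, Finsupp.linearCombination_apply, Finsupp.sum, smul_eq_mul, mul_one] at hf ⊢
    rw [← Finset.sum_fiberwise_of_maps_to (t := f.support.image fun c => B c.1 c.1)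
      (g := fun c => B c.1 c.1) fun c hc => Finset.mem_image_of_mem _ hc]
    refine Finset.sum_eq_zero fun β hβ => ?_
    obtain ⟨c₀, -, hc₀⟩ := Finset.mem_image.mp hβ
    set w := ∑ c ∈ f.support with B c.1 c.1 = β, f c • c.1 with hw
    clear_value w
    have hwc : ∀ c : I, B c.1 c.1 ≠ β → B w c.1 = 0 := by
      intro c hc
      rw [hw, map_sum, LinearMap.sum_apply]
      refine Finset.sum_eq_zero fun d hd => ?_
      rw [map_smul, LinearMap.smul_apply]
      by_contra hne
      have hdc : B d.1 c.1 ≠ 0 := fun h => hne (by rw [h, smul_zero])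
      have := form_self_eq_of_form_ne_zero hB d.2.1 c.2.1 hdc
      exact hc (this.symm.trans (Finset.mem_filter.mp hd).2)
    have hww : B w w = 0 := by
      have h0 : B w (∑ c ∈ f.support, f c • c.1) = 0 := by rw [hf, map_zero]
      have h1 : B w w = B w (∑ c ∈ f.support with B c.1 c.1 = β, f c • c.1) := by rw [← hw]
      refine h1.trans (Eq.trans ?_ h0)
      rw [map_sum, map_sum, Finset.sum_filter]
      refine Finset.sum_congr rfl fun c _ => ?_
      split_ifs with h
      · rfl
      · rw [map_smul, hwc c h, smul_zero]
    have hw0 : w = 0 := by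
      by_contra h
      exact (hpos w h).ne' hww
    have h1 : B w 1 = β * ∑ c ∈ f.support with B c.1 c.1 = β, f c := by
      rw [hw, map_sum, LinearMap.sum_apply, Finset.mul_sum]
      refine Finset.sum_congr rfl fun c hc => ?_
      have hcc : c.1 * c.1 = c.1 := c.2.1.1
      have : B c.1 1 = B c.1 c.1 := by
        rw [← mul_one c.1, ← hB, mul_one, hcc]
      rw [map_smul, LinearMap.smul_apply, this, (Finset.mem_filter.mp hc).2, smul_eq_mul, mul_comm]
    rw [hw0, map_zero, LinearMap.zero_apply] at h1
    refine (mul_eq_zero.mp h1.symm).resolve_left ?_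
    rw [← hc₀]
    exact (hpos _ c₀.2.2).ne'
  have hsurj : LinearMap.range lc = ⊤ := by
    rw [eq_top_iff]
    rintro x -
    obtain ⟨k, l, c, hc, rfl⟩ := exists_isJordanFrame x
    refine Submodule.sum_mem _ fun i _ => Submodule.smul_mem _ _ ?_
    exact ⟨Finsupp.single ⟨c i, hc.primitive i, hc.ne_zero i⟩ 1, by simp [lc]⟩
  obtain ⟨g, hg⟩ := lc.exists_rightInverse_of_surjective hsurj
  refine ⟨sm ∘ₗ g, fun c hc hc0 => ?_⟩
  have h := hker (g c - Finsupp.single ⟨c, hc, hc0⟩ 1) (by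
    rw [map_sub, ← LinearMap.comp_apply, hg]
    simp [lc])
  rw [map_sub, sub_eq_zero] at h
  rw [LinearMap.comp_apply, h]
  simp [sm]

/-- The functional returns the eigenvalue sum of every spectral decomposition, so the arbitrary
choice inside `eigenvalues` does not affect the trace. -/
theorem trace_eq_linear {τ : V →ₗ[ℝ] ℝ}
    (hτ : ∀ c : V, IsPrimitiveIdempotent c → c ≠ 0 → τ c = 1) (x : V) : trace x = τ x := by
  have h : ∃ s, IsSpectrum x s := by
    obtain ⟨k, l, c, hc, hx⟩ := exists_isJordanFrame x
    exact ⟨_, k, l, c, hc, hx, rfl⟩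
  rw [trace, eigenvalues, dif_pos h]
  obtain ⟨k, l, c, hc, hx, hs⟩ := h.choose_spec
  rw [hs, hx, sum_smul_isJordanFrame hτ hc]
  rfl

/-! ### The trace inner product, orthogonal projections and the spectraplex. -/

variable (V) in
/-- The trace inner product as a bilinear form. -/
theorem exists_traceInner_form :
    ∃ F : LinearMap.BilinForm ℝ V, ∀ x y : V, traceInner x y = F x y := by
  obtain ⟨τ, hτ⟩ := exists_linear_trace V
  exact ⟨(LinearMap.mul ℝ V).compr₂ τ, fun x y => trace_eq_linear hτ _⟩

theorem traceInner_self_isJordanFrame {k : ℕ} {c : Fin k → V} (hc : IsJordanFrame c)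
    (l : Fin k → ℝ) :
    traceInner (∑ i, l i • c i) (∑ i, l i • c i) = ∑ i, l i ^ 2 := by
  obtain ⟨τ, hτ⟩ := exists_linear_trace V
  rw [traceInner, trace_eq_linear hτ, mul_self_isJordanFrame hc, sum_smul_isJordanFrame hτ hc]

theorem traceInner_self_nonneg (x : V) : 0 ≤ traceInner x x := by
  obtain ⟨k, l, c, hc, rfl⟩ := exists_isJordanFrame x
  rw [traceInner_self_isJordanFrame hc]
  exact Finset.sum_nonneg fun i _ => sq_nonneg _

theorem frobNorm_sq (x : V) : frobNorm x ^ 2 = traceInner x x :=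
  Real.sq_sqrt (traceInner_self_nonneg x)

/-- An orthogonal projection is a contraction and may be dropped from an inner product. -/
theorem IsOrthogonalProjection.traceInner_map_self_le {L : Submodule ℝ V} {P : V →ₗ[ℝ] V}
    (hP : IsOrthogonalProjection L P) (x : V) : traceInner (P x) (P x) ≤ traceInner x x := by
  obtain ⟨F, hF⟩ := exists_traceInner_form V
  have h1 := (hP x).2 (P x) (hP x).1
  have h2 := traceInner_self_nonneg (x - P x)
  have h3 : F (P x) x = F x (P x) := by
    rw [← hF, ← hF, traceInner, traceInner, mul_comm]
  simp only [hF, map_sub, LinearMap.sub_apply] at h1 h2 ⊢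
  linarith

theorem IsOrthogonalProjection.traceInner_map_map {L : Submodule ℝ V} {P : V →ₗ[ℝ] V}
    (hP : IsOrthogonalProjection L P) (x y : V) :
    traceInner (P x) (P y) = traceInner x (P y) := by
  obtain ⟨F, hF⟩ := exists_traceInner_form V
  have h1 := (hP x).2 (P y) (hP y).1
  simp only [hF, map_sub, LinearMap.sub_apply] at h1 ⊢
  linarith

variable [TopologicalSpace V] [IsTopologicalAddGroup V] [ContinuousSMul ℝ V] [T2Space V]

/-- Eigenvalues are nonnegative on the closure of the cone of squares. -/
theorem nonneg_of_mem_closure_coneInterior {k : ℕ} {c : Fin k → V} (hc : IsJordanFrame c)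
    {l : Fin k → ℝ} (h : ∑ i, l i • c i ∈ closure (coneInterior V)) (i : Fin k) : 0 ≤ l i := by
  obtain ⟨B, hpos, hB⟩ := exists_form (V := V)
  have hcc : c i * c i = c i := (hc.primitive i).1
  have hclosed : IsClosed {x : V | 0 ≤ B (c i) x} :=
    isClosed_le continuous_const (B (c i)).continuous_of_finiteDimensional
  have hsub : closure (coneInterior V) ⊆ {x : V | 0 ≤ B (c i) x} := by
    refine closure_minimal (interior_subset.trans ?_) hclosed
    -- On squares, B(c, x²) = B(c∘x, x) ≥ 0.
    rintro _ ⟨x, rfl⟩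
    change 0 ≤ B (c i) (x * x)
    rw [← hB]
    exact form_idempotent_mul_self_nonneg hpos hB hcc x
  have h0 : 0 ≤ B (c i) (∑ j, l j • c j) := hsub h
  rw [map_sum, Finset.sum_eq_single_of_mem i (Finset.mem_univ i), map_smul, smul_eq_mul] at h0
  · exact nonneg_of_mul_nonneg_left h0 (hpos _ (hc.ne_zero i))
  · intro j _ hji
    rw [map_smul, ← hcc, hB, hc.orthogonal i j hji.symm, map_zero, smul_zero]

/-- The eigenvalues are nonnegative with sum 1, so their squares sum to at most 1. -/
theorem traceInner_self_le_one {u : V} (hu : u ∈ spectraplex V) : traceInner u u ≤ 1 := by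
  obtain ⟨τ, hτ⟩ := exists_linear_trace V
  obtain ⟨k, l, c, hc, rfl⟩ := exists_isJordanFrame u
  have hl := nonneg_of_mem_closure_coneInterior hc hu.1
  have hsum : ∑ i, l i = 1 := by
    have h := hu.2
    rwa [traceInner, one_mul, trace_eq_linear hτ, sum_smul_isJordanFrame hτ hc] at h
  rw [traceInner_self_isJordanFrame hc]
  calc ∑ i, l i ^ 2 ≤ (∑ i, l i) ^ 2 := Finset.sum_sq_le_sq_sum_of_nonneg fun i _ => hl i
    _ = 1 := by rw [hsum, one_pow]

end Trace

end EuclideanJordanAlgebra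

/-! ### The perceptron estimate. -/

theorem mainTheorem7 {V : Type*} [NonAssocCommRing V] [Module ℝ V] [EuclideanJordanAlgebra V]
    [FiniteDimensional ℝ V] [TopologicalSpace V] [IsTopologicalAddGroup V] [ContinuousSMul ℝ V]
    [T2Space V]
    (L : Submodule ℝ V) (P : V →ₗ[ℝ] V)
    (hP : EuclideanJordanAlgebra.IsOrthogonalProjection L P)
    (t : ℕ) (ht : 1 ≤ t) (z : ℕ → V)
    (hz : EuclideanJordanAlgebra.IsPerceptronRun P t z) :
    EuclideanJordanAlgebra.frobNorm (P (z t)) ^ 2 ≤ 1 / (t : ℝ) := by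
  obtain ⟨F, hF⟩ := EuclideanJordanAlgebra.exists_traceInner_form V
  suffices h : ∀ s, s < t → EuclideanJordanAlgebra.traceInner (P (z (s + 1))) (P (z (s + 1))) ≤
      1 / ((s : ℝ) + 1) by
    obtain ⟨s, rfl⟩ := Nat.exists_eq_add_of_le' ht
    rw [EuclideanJordanAlgebra.frobNorm_sq]
    exact_mod_cast h s (Nat.lt_succ_self s)
  intro s
  induction s with
  | zero =>
    intro hs
    obtain ⟨u, hu, -, hstep⟩ := hz.step 0 hs
    -- The first step has weight 1/(0 + 1) = 1, so `z 0` drops out.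
    have hzu : z (0 + 1) = u := by simpa using hstep
    rw [hzu]
    simpa using (hP.traceInner_map_self_le u).trans
      (EuclideanJordanAlgebra.traceInner_self_le_one hu)
  | succ s ih =>
    intro hs
    obtain ⟨u, hu, hneg, hstep⟩ := hz.step (s + 1) hs
    have ih := ih (Nat.lt_of_succ_lt hs)
    have h1 := (hP.traceInner_map_self_le u).trans
      (EuclideanJordanAlgebra.traceInner_self_le_one hu)
    rw [← hP.traceInner_map_map] at hneg
    have hsymm : F (P (z (s + 1))) (P u) = F (P u) (P (z (s + 1))) := by
      rw [← hF, ← hF, EuclideanJordanAlgebra.traceInner, EuclideanJordanAlgebra.traceInner,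
        mul_comm]
    rw [hstep]
    simp only [hF, map_add, map_smul, LinearMap.add_apply, LinearMap.smul_apply, smul_eq_mul,
      hsymm] at ih h1 hneg ⊢
    push_cast
    have hn : (0 : ℝ) < (s : ℝ) + 1 := by positivity
    -- From here the claim is scalar: A = ‖P z_n‖², C = ⟨Pu, P z_n⟩ ≤ 0, D = ‖Pu‖² ≤ 1.
    generalize (s : ℝ) + 1 = n at *
    generalize F (P (z (s + 1))) (P (z (s + 1))) = A at *
    generalize F (P u) (P (z (s + 1))) = C at *
    generalize F (P u) (P u) = D at *
    have hA : n * A ≤ 1 := by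
      rw [le_div_iff₀ hn] at ih
      linarith
    have hn1 : (0 : ℝ) < n + 1 := by linarith
    have e : (1 - 1 / (n + 1)) * ((1 - 1 / (n + 1)) * A) + 1 / (n + 1) * ((1 - 1 / (n + 1)) * C) +
        ((1 - 1 / (n + 1)) * (1 / (n + 1) * C) + 1 / (n + 1) * (1 / (n + 1) * D)) =
        (n * (n * A) + 2 * (n * C) + D) / (n + 1) ^ 2 := by
      field_simp
      ring
    have hle : n * (n * A) + 2 * (n * C) + D ≤ n + 1 := by
      have := mul_le_mul_of_nonneg_left hA hn.le
      have := mul_nonpos_of_nonneg_of_nonpos hn.le hneg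
      linarith
    have hfin : (n * (n * A) + 2 * (n * C) + D) / (n + 1) ^ 2 ≤ 1 / (n + 1) := by
      rw [div_le_div_iff₀ (by positivity) hn1]
      calc _ ≤ (n + 1) * (n + 1) := mul_le_mul_of_nonneg_right hle hn1.le
        _ = _ := by ring
    refine le_trans (le_of_eq ?_) hfin
    rw [← e]
    ring
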